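/- Let $[n]=\{1,2,\ldots,n\}$. A standard edge of a set partition $\pi$ of $[n]$ is a pair $(i,j)$ of integers with $i<j$ lying in the same block of $\pi$ such that this block contains no integer strictly between $i$ and $j$. A $3$-distant crossing of $\pi$ is a pair of standard edges $(i_1,j_1)$, $(i_2,j_2)$ of $\pi$ with $i_1<i_2<j_1<j_2$ and $j_1-i_2\ge 3$, and $\pi$ is $3$-distant noncrossing if it has no $3$-distant crossing. A Motzkin path of length $n$ is a lattice path from $(0,0)$ to $(n,0)$ with up steps $(1,1)$, horizontal steps $(1,0)$ and down steps $(1,-1)$ that never goes below the $x$-axis; the height of a step is the ordinate of its starting point. For real sequences $b=(b_0,b_1,b_2,\ldots)$ and $\lambda=(\lambda_1,\lambda_2,\ldots)$, the weight of a Motzkin path with respect to $b$ and $\lambda$ is the product of $b_i$ over all horizontal steps of height $i$ and $\lambda_i$ over all down steps of height $i$ (an empty product being $1$). **Corollary 3.5** (Drake–Kim, Conjecture 6.2). For every integer $n\ge 0$, the number of $3$-distant noncrossing partitions of $[n]$ is equal to the sum of the weights of all Motzkin paths of length $n$ with respect to $b=(b_0,b_1,b_2,b_3,\ldots)=(1,2,3,3,3,\ldots)$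 and $\lambda=(\lambda_1,\lambda_2,\lambda_3,\ldots)=(1,2,2,2,\ldots)$. -/

import Mathlib

/-- `(i, j)` is a standard edge of the set partition `P` of `[n] = {1, …, n}`: `i < j` lie in the
same block of `P`, and this block contains no integer strictly between `i` and `j`. -/
def IsStandardEdge {n : ℕ} (P : Finpartition (Finset.Icc 1 n)) (i j : ℕ) : Prop :=
  i < j ∧ ∃ B ∈ P.parts, i ∈ B ∧ j ∈ B ∧ ∀ m ∈ B, ¬ (i < m ∧ m < j)

/-- The standard edges `(i₁, j₁)` and `(i₂, j₂)` of `P` form a `k`-distant crossing: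
`i₁ < i₂ < j₁ < j₂` and `j₁ - i₂ ≥ k`. -/
def IsDistantCrossing {n : ℕ} (k : ℕ) (P : Finpartition (Finset.Icc 1 n))
    (i₁ j₁ i₂ j₂ : ℕ) : Prop :=
  IsStandardEdge P i₁ j₁ ∧ IsStandardEdge P i₂ j₂ ∧
    i₁ < i₂ ∧ i₂ < j₁ ∧ j₁ < j₂ ∧ i₂ + k ≤ j₁

/-- `P` is a `k`-distant noncrossing partition: it has no `k`-distant crossing. -/
def IsDistantNoncrossing {n : ℕ} (k : ℕ) (P : Finpartition (Finset.Icc 1 n)) : Prop :=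
  ∀ i₁ j₁ i₂ j₂ : ℕ, ¬ IsDistantCrossing k P i₁ j₁ i₂ j₂

/-- The number of `k`-distant noncrossing partitions of `[n]`. -/
noncomputable def distantNoncrossingCount (k n : ℕ) : ℕ :=
  Nat.card {P : Finpartition (Finset.Icc 1 n) // IsDistantNoncrossing k P}

/-- The steps of a Motzkin path: `(1, 1)`, `(1, 0)` and `(1, -1)`. -/
inductive MotzkinStep
  | up
  | horizontal
  | down
  deriving DecidableEq

instance : Fintype MotzkinStep where
  elems := {.up, .horizontal, .down}
  complete := by intro s; cases s <;> simp

/-- The vertical displacement of a step. -/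
def MotzkinStep.rise : MotzkinStep → ℤ
  | .up => 1
  | .horizontal => 0
  | .down => -1

/-- The ordinate, after the first `i` steps, of the lattice path that starts at `(0, 0)` and has
step sequence `p`. -/
def pathHeight {n : ℕ} (p : Fin n → MotzkinStep) (i : ℕ) : ℤ :=
  ∑ j : Fin n with j.val < i, (p j).rise

/-- The step sequence `p` is a Motzkin path of length `n`: the path runs from `(0, 0)` to `(n, 0)`
and never goes below the `x`-axis. -/
def IsMotzkinPath {n : ℕ} (p : Fin n → MotzkinStep) : Prop :=
  (∀ i ≤ n, 0 ≤ pathHeight p i) ∧ pathHeight p n = 0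

instance {n : ℕ} : DecidablePred (IsMotzkinPath (n := n)) := fun p => by
  unfold IsMotzkinPath
  infer_instance

/-- The weight of a Motzkin path with respect to the sequences `b = (b 0, b 1, …)` and
`lam = (lam 1, lam 2, …)`: the product of `b i` over the horizontal steps of height `i` and
`lam i` over the down steps of height `i`, where the height of a step is the ordinate of its
starting point. Up steps have weight `1`. (On a Motzkin path every height is nonnegative and every
down step has height at least `1`, so `toNat` loses nothing and `lam 0` is never used.) -/
noncomputable def motzkinWeight (b lam : ℕ → ℝ) {n : ℕ} (p : Fin n → MotzkinStep) : ℝ :=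
  ∏ j : Fin n, match p j with
    | .up => 1
    | .horizontal => b (pathHeight p j.val).toNat
    | .down => lam (pathHeight p j.val).toNat

/-- The sum of the weights of all Motzkin paths of length `n`. -/
noncomputable def motzkinWeightSum (b lam : ℕ → ℝ) (n : ℕ) : ℝ :=
  ∑ p : Fin n → MotzkinStep with IsMotzkinPath p, motzkinWeight b lam p

/-!
A set partition of `[n]` is encoded by its predecessor function: `j` is sent to the left end of the
standard edge ending at `j`, or to `0` if there is none. The functions that arise from `3`-distant
noncrossing partitions are exactly those satisfying `IsNoncrossingPred`
(`distantNoncrossingCount_three`), and they are built by choosing the predecessors of `1, 2, …` one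
after the other.

At each moment a vertex `i` is *available* if it may still become the predecessor of a later
vertex. Choosing `c` as the predecessor of the new vertex `n + 1` uses up `c`, and it makes unusable
all `i` with `c < i ≤ n - 2`, since a later edge starting at such an `i` would cross the edge
`(c, n + 1)` at distance at least `3`. Hence the number of ways to continue depends only on the
number of available vertices `≤ n - 2` and on whether `n - 1` is available (`n` always is). This
gives the two-parameter recursion `extensionCount`, by `card_noncrossingPreds_succ`.

Both this recursion and the recursion for weighted Motzkin paths by starting height are solved
explicitly by power series in `z`. Let `s` be the generating function of the large Schröder numbers,
so `s = 1 + z s + z s²`, and put `κ = 1 / (z + s (1 - z)²)`. Motzkin paths from height `i ≥ 1` have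
generating function `κ z s² (s - 1)^(i - 1)`, while extensions from a state with `h` old available
vertices have generating function `κ s² (1 + z s²)^h` or
`κ s (1 + z s²)^h + (1 - κ) / (1 - z)`, according to whether the last but one vertex is available.
The recursions determine all coefficients, so checking them identifies the series
(`coeff_motzkinSeries`, `coeff_extensionSeries`), and the theorem becomes the identity
`motzkinSeries_zero_eq_extensionSeries` between the two solutions.
-/

/-! ### The Schröder series and the series built from it -/

open PowerSeries in
/-- The generating function of the large Schröder numbers, over `ℝ`. -/
noncomputable def schroderSeries : PowerSeries ℝ :=
  largeSchroderSeries.map (Nat.castRingHom ℝ)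

open PowerSeries in
theorem schroderSeries_eq :
    schroderSeries = 1 + X * schroderSeries + X * schroderSeries ^ 2 := by
  have h := congrArg (PowerSeries.map (Nat.castRingHom ℝ))
    largeSchroderSeries_eq_one_add_X_mul_largeSchroderSeries_add_X_mul_largeSchroderSeries_sq
  simpa only [schroderSeries, map_add, map_mul, map_pow, map_one, map_X] using h

theorem constantCoeff_schroderSeries :
    PowerSeries.constantCoeff schroderSeries = 1 := by
  simp [schroderSeries, ← PowerSeries.coeff_zero_eq_constantCoeff_apply]

/-- The series `κ = 1 / (z + s (1 - z)²)`, where `s` is the large Schröder series; the denominator has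
constant coefficient `1`. -/
noncomputable def kernelSeries : PowerSeries ℝ :=
  (PowerSeries.X + schroderSeries * (1 - PowerSeries.X) ^ 2)⁻¹

theorem kernelSeries_mul :
    kernelSeries * (PowerSeries.X + schroderSeries * (1 - PowerSeries.X) ^ 2) = 1 :=
  PowerSeries.inv_mul_cancel _ (by simp [constantCoeff_schroderSeries])

theorem inv_one_sub_X_mul : (1 - PowerSeries.X : PowerSeries ℝ)⁻¹ * (1 - PowerSeries.X) = 1 :=
  PowerSeries.inv_mul_cancel _ (by simp)

/-! ### The generating functions of weighted Motzkin paths -/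

/-- The generating function, by length, of the weighted Motzkin paths that start at height `i`, for
`b = (1, 2, 3, 3, …)` and `λ = (1, 2, 2, …)`; see `coeff_motzkinSeries`. For `i ≥ 1` it is geometric
with ratio `r = s - 1`, the power series solution of `r = z (r² + 3 r + 2)`. -/
noncomputable def motzkinSeries : ℕ → PowerSeries ℝ
  | 0 => (1 - PowerSeries.X)⁻¹ *
      (1 + PowerSeries.X * (kernelSeries * (PowerSeries.X * schroderSeries ^ 2)))
  | i + 1 => kernelSeries * (PowerSeries.X * schroderSeries ^ 2) * (schroderSeries - 1) ^ i

open PowerSeries in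
theorem motzkinSeries_zero_eq :
    motzkinSeries 0 = 1 + X * (motzkinSeries 1 + motzkinSeries 0) := by
  simp only [motzkinSeries, pow_zero, mul_one]
  linear_combination (1 + X * (kernelSeries * (X * schroderSeries ^ 2))) * inv_one_sub_X_mul

open PowerSeries in
theorem motzkinSeries_one_eq :
    motzkinSeries 1 = X * (motzkinSeries 2 + 2 * motzkinSeries 1 + motzkinSeries 0) := by
  have hs := schroderSeries_eq
  have hk := kernelSeries_mul
  have hw := inv_one_sub_X_mul
  -- it suffices to compare after multiplication by the unit `1 - X`
  have h : (1 - X : PowerSeries ℝ) * motzkinSeries 1 =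
      (1 - X) * (X * (motzkinSeries 2 + 2 * motzkinSeries 1 + motzkinSeries 0)) := by
    simp only [motzkinSeries, pow_zero, mul_one, pow_one]
    generalize schroderSeries = s at *
    generalize kernelSeries = k at *
    generalize (1 - X : PowerSeries ℝ)⁻¹ = w at *
    linear_combination (-X * (1 + X * (k * (X * s ^ 2)))) * hw + X * hk
      + k * X * ((1 - X) * s + X) * hs 
  calc motzkinSeries 1 = (1 - X : PowerSeries ℝ)⁻¹ * ((1 - X) * motzkinSeries 1) := by
        rw [← mul_assoc, hw, one_mul]
    _ = _ := by rw [h, ← mul_assoc, hw, one_mul]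

open PowerSeries in
theorem motzkinSeries_add_two_eq (i : ℕ) :
    motzkinSeries (i + 2) =
      X * (motzkinSeries (i + 3) + 3 * motzkinSeries (i + 2) + 2 * motzkinSeries (i + 1)) := by
  simp only [motzkinSeries, pow_succ (schroderSeries - 1)]
  linear_combination
    kernelSeries * (X * schroderSeries ^ 2) * (schroderSeries - 1) ^ i * schroderSeries_eq

/-! ### Counting extensions -/

/-- The number of ways to add `m` vertices to a `3`-distant noncrossing partition of `[n]`, `n ≥ 1`,
that has `h` available vertices `≤ n - 2`, where the flag says whether `n - 1` is available.
The first terms of the recursion correspond to a new vertex without predecessor, or with predecessor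
`n` or `n - 1`; in the sum, the predecessor is the available vertex `≤ n - 2` that has `k` available
vertices below it, and only these `k` survive among the old ones. -/
def extensionCount : ℕ → ℕ → Bool → ℕ
  | 0, _, _ => 1
  | m + 1, h, false => extensionCount m h true + extensionCount m h false +
      ∑ k ∈ Finset.range h, extensionCount m k true
  | m + 1, h, true => extensionCount m (h + 1) true + extensionCount m (h + 1) false +
      extensionCount m h true + ∑ k ∈ Finset.range h, extensionCount m (k + 1) true

/-- The generating function of `extensionCount` in the number of added vertices; see
`coeff_extensionSeries`. -/
noncomputable def extensionSeries (h : ℕ) : Bool → PowerSeries ℝ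
  | false => kernelSeries * schroderSeries * (1 + PowerSeries.X * schroderSeries ^ 2) ^ h +
      (1 - kernelSeries) * (1 - PowerSeries.X)⁻¹
  | true => kernelSeries * schroderSeries ^ 2 * (1 + PowerSeries.X * schroderSeries ^ 2) ^ h

open PowerSeries in
theorem X_mul_sum_extensionSeries_true (h : ℕ) :
    X * ∑ k ∈ Finset.range h, extensionSeries k true =
      kernelSeries * ((1 + X * schroderSeries ^ 2) ^ h - 1) := by
  rw [← mul_geom_sum]
  simp only [extensionSeries, ← Finset.mul_sum]
  ring

open PowerSeries in
theorem extensionSeries_false_eq (h : ℕ) :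
    extensionSeries h false = 1 + X * (extensionSeries h true + extensionSeries h false +
      ∑ k ∈ Finset.range h, extensionSeries k true) := by
  rw [mul_add, X_mul_sum_extensionSeries_true]
  simp only [extensionSeries]
  linear_combination (1 - kernelSeries) * inv_one_sub_X_mul +
    kernelSeries * (1 + X * schroderSeries ^ 2) ^ h * schroderSeries_eq

open PowerSeries in
theorem extensionSeries_true_eq (h : ℕ) :
    extensionSeries h true = 1 + X * (extensionSeries (h + 1) true +
      extensionSeries (h + 1) false + extensionSeries h true +
      ∑ k ∈ Finset.range h, extensionSeries (k + 1) true) := by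
  have hsum : ∑ k ∈ Finset.range h, extensionSeries (k + 1) true =
      (1 + X * schroderSeries ^ 2) * ∑ k ∈ Finset.range h, extensionSeries k true := by
    simp only [extensionSeries, Finset.mul_sum, pow_succ _ _]
    exact Finset.sum_congr rfl fun _ _ => by ring
  rw [hsum, mul_add, mul_left_comm, X_mul_sum_extensionSeries_true]
  simp only [extensionSeries, pow_succ _ h]
  have hs := schroderSeries_eq
  have hk := kernelSeries_mul
  have hw := inv_one_sub_X_mul
  generalize hr : 1 + X * schroderSeries ^ 2 = r at *
  generalize hp : r ^ h = p at *
  generalize schroderSeries = s at *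
  generalize kernelSeries = k at *
  generalize (1 - X : PowerSeries ℝ)⁻¹ = w at *
  -- since `1 + z s² = s (1 - z)`, only the defining equations of `s`, `κ` and `1 / (1 - z)` are needed
  have hrs : r = s * (1 - X) := by linear_combination -hs - hr
  subst hrs
  linear_combination k * p * s * (1 - X) * hs + w * hk - (s * k * (1 - X) - 1) * hw

theorem coeff_extensionSeries (m h : ℕ) (f : Bool) :
    PowerSeries.coeff m (extensionSeries h f) = (extensionCount m h f : ℝ) := by
  induction m generalizing h f with
  | zero =>
    cases f
    · rw [extensionSeries_false_eq]; simp [extensionCount]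
    · rw [extensionSeries_true_eq]; simp [extensionCount]
  | succ m ih =>
    cases f
    · rw [extensionSeries_false_eq, map_add, PowerSeries.coeff_succ_X_mul]
      simp [extensionCount, ih, PowerSeries.coeff_one]
    · rw [extensionSeries_true_eq, map_add, PowerSeries.coeff_succ_X_mul]
      simp [extensionCount, ih, PowerSeries.coeff_one]

open PowerSeries in
theorem motzkinSeries_zero_eq_extensionSeries :
    motzkinSeries 0 = 1 + X * extensionSeries 0 false := by
  simp only [motzkinSeries, extensionSeries, pow_zero, mul_one]
  have hs := schroderSeries_eq
  have hk := kernelSeries_mul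
  have hw := inv_one_sub_X_mul
  generalize schroderSeries = s at *
  generalize kernelSeries = k at *
  generalize (1 - X : PowerSeries ℝ)⁻¹ = w at *
  linear_combination (1 + X * k * s) * hw - w * X * k * hs

/-! ### The recursion for weighted Motzkin paths -/

/-- The contribution of a step `s` of height `i` to the weight of a path. -/
def MotzkinStep.weight (b lam : ℕ → ℝ) (s : MotzkinStep) (i : ℕ) : ℝ :=
  match s with
  | .up => 1
  | .horizontal => b i
  | .down => lam i

/-- The path with step sequence `p` that starts at height `i` never goes below the `x`-axis and ends
on it. -/
def IsMotzkinPathFrom (i : ℤ) {n : ℕ} (p : Fin n → MotzkinStep) : Prop :=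
  (∀ k ≤ n, 0 ≤ i + pathHeight p k) ∧ i + pathHeight p n = 0

open Classical in
/-- The sum of the weights of all paths of length `n` from height `i` to height `0` that stay
nonnegative. The height `i` is an integer so that a down step from height `0` needs no special
treatment: the sum vanishes for `i < 0`. -/
noncomputable def motzkinWeightSumFrom (b lam : ℕ → ℝ) (n : ℕ) (i : ℤ) : ℝ :=
  ∑ p : Fin n → MotzkinStep, if IsMotzkinPathFrom i p then
    ∏ j : Fin n, (p j).weight b lam (i + pathHeight p j.val).toNat else 0

theorem pathHeight_zero {n : ℕ} (p : Fin n → MotzkinStep) : pathHeight p 0 = 0 := by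
  simp [pathHeight]

theorem pathHeight_cons_succ {n : ℕ} (s : MotzkinStep) (p : Fin n → MotzkinStep) (k : ℕ) :
    pathHeight (Fin.cons s p : Fin (n + 1) → MotzkinStep) (k + 1) = s.rise + pathHeight p k := by
  simp [pathHeight, Finset.sum_filter, Fin.sum_univ_succ]

theorem isMotzkinPathFrom_cons {i : ℤ} {n : ℕ} (s : MotzkinStep) (p : Fin n → MotzkinStep) :
    IsMotzkinPathFrom i (Fin.cons s p : Fin (n + 1) → MotzkinStep) ↔
      0 ≤ i ∧ IsMotzkinPathFrom (i + s.rise) p := by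
  simp only [IsMotzkinPathFrom, pathHeight_cons_succ, add_assoc]
  constructor
  · rintro ⟨h, h'⟩
    exact ⟨by simpa [pathHeight_zero] using h 0 (by simp),
      fun k hk => by simpa [pathHeight_cons_succ] using h (k + 1) (by simpa using hk), h'⟩
  · rintro ⟨h0, h, h'⟩
    refine ⟨fun k hk => ?_, h'⟩
    cases k with
    | zero => simpa [pathHeight_zero] using h0
    | succ k => simpa [pathHeight_cons_succ] using h k (by simpa using hk)

theorem motzkinWeightSumFrom_zero (b lam : ℕ → ℝ) (i : ℤ) :
    motzkinWeightSumFrom b lam 0 i = if i = 0 then 1 else 0 := by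
  simp [motzkinWeightSumFrom, IsMotzkinPathFrom, pathHeight_zero]
  grind

theorem motzkinWeightSumFrom_of_neg (b lam : ℕ → ℝ) (n : ℕ) {i : ℤ} (hi : i < 0) :
    motzkinWeightSumFrom b lam n i = 0 := by
  refine Finset.sum_eq_zero fun p _ => if_neg fun h => ?_
  have := h.1 0 (Nat.zero_le _)
  rw [pathHeight_zero] at this
  lia

theorem motzkinWeightSumFrom_succ (b lam : ℕ → ℝ) (n i : ℕ) :
    motzkinWeightSumFrom b lam (n + 1) i = motzkinWeightSumFrom b lam n (i + 1) +
      b i * motzkinWeightSumFrom b lam n i + lam i * motzkinWeightSumFrom b lam n (i - 1) := by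
  have h : motzkinWeightSumFrom b lam (n + 1) i =
      ∑ s : MotzkinStep, s.weight b lam i * motzkinWeightSumFrom b lam n (i + s.rise) := by
    rw [motzkinWeightSumFrom, ← (Fin.consEquiv fun _ => MotzkinStep).sum_comp,
      Fintype.sum_prod_type]
    refine Finset.sum_congr rfl fun s _ => ?_
    rw [motzkinWeightSumFrom, Finset.mul_sum]
    refine Finset.sum_congr rfl fun p _ => ?_
    have hp : IsMotzkinPathFrom i (Fin.cons s p : Fin (n + 1) → MotzkinStep) ↔
        IsMotzkinPathFrom (i + s.rise) p := by simp [isMotzkinPathFrom_cons]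
    have hcons : Fin.consEquiv (fun _ => MotzkinStep) (s, p) = Fin.cons s p := rfl
    rw [hcons]
    by_cases hq : IsMotzkinPathFrom (i + s.rise) p
    · rw [if_pos hq, if_pos (hp.2 hq)]
      simp [Fin.prod_univ_succ, pathHeight_zero, pathHeight_cons_succ, add_assoc]
    · rw [if_neg hq, if_neg (mt hp.1 hq), mul_zero]
  have huniv : (Finset.univ : Finset MotzkinStep) = {.up, .horizontal, .down} := rfl
  rw [h, huniv]
  simp [MotzkinStep.weight, MotzkinStep.rise, add_assoc, sub_eq_add_neg]

theorem motzkinWeightSum_eq_from (b lam : ℕ → ℝ) (n : ℕ) :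
    motzkinWeightSum b lam n = motzkinWeightSumFrom b lam n 0 := by
  rw [motzkinWeightSum, motzkinWeightSumFrom, Finset.sum_filter]
  refine Finset.sum_congr rfl fun p _ => ?_
  simp only [IsMotzkinPath, IsMotzkinPathFrom, zero_add]
  rfl

theorem coeff_motzkinSeries {b lam : ℕ → ℝ}
    (hb₀ : b 0 = 1) (hb₁ : b 1 = 2) (hb : ∀ i : ℕ, 2 ≤ i → b i = 3)
    (hlam₁ : lam 1 = 1) (hlam : ∀ i : ℕ, 2 ≤ i → lam i = 2) (n i : ℕ) :
    PowerSeries.coeff n (motzkinSeries i) = motzkinWeightSumFrom b lam n i := by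
  induction n generalizing i with
  | zero =>
    rw [motzkinWeightSumFrom_zero]
    rcases i with _ | _ | i
    · rw [motzkinSeries_zero_eq]; simp
    · rw [motzkinSeries_one_eq]; simp
    · rw [motzkinSeries_add_two_eq]; simp; lia
  | succ n ih =>
    have h2 : ∀ f : PowerSeries ℝ, PowerSeries.coeff n (2 * f) = 2 * PowerSeries.coeff n f :=
      fun f => by
      rw [← map_ofNat (PowerSeries.C (R := ℝ)) 2, PowerSeries.coeff_C_mul]
    have h3 : ∀ f : PowerSeries ℝ, PowerSeries.coeff n (3 * f) = 3 * PowerSeries.coeff n f :=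
      fun f => by
      rw [← map_ofNat (PowerSeries.C (R := ℝ)) 3, PowerSeries.coeff_C_mul]
    rw [motzkinWeightSumFrom_succ]
    rcases i with _ | _ | i
    · rw [motzkinSeries_zero_eq, map_add, PowerSeries.coeff_succ_X_mul,
        motzkinWeightSumFrom_of_neg b lam n (i := ((0 : ℕ) : ℤ) - 1) (by simp)]
      simp [PowerSeries.coeff_one, ih, hb₀]
    · rw [motzkinSeries_one_eq, PowerSeries.coeff_succ_X_mul]
      simp [ih, hb₁, hlam₁, h2, one_add_one_eq_two]
    · rw [motzkinSeries_add_two_eq, PowerSeries.coeff_succ_X_mul, hb _ (by lia), hlam _ (by lia)]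
      simp only [map_add, h2, h3, ih]
      push_cast
      ring_nf

/-! ### Predecessor functions -/

/-- `f` is the predecessor function of a `3`-distant noncrossing partition of `[n]`: `f j` is the
left end of the standard edge that ends at `j`, and `f j = 0` if there is no such edge. -/
structure IsNoncrossingPred (n : ℕ) (f : ℕ → ℕ) : Prop where
  lt : ∀ j, f j ≠ 0 → f j < j
  le : ∀ j, f j ≠ 0 → j ≤ n
  inj : ∀ j k, f j ≠ 0 → f j = f k → j = k
  noncrossing : ∀ j k, f j ≠ 0 → ¬ (f j < f k ∧ f k + 3 ≤ j ∧ j < k)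

/-- The vertices of `[n]` that can become the predecessor of a vertex after `n`: those that do not
start an edge already and whose edge would not form a `3`-distant crossing with an edge
`(f j, j)`. -/
def available (n : ℕ) (f : ℕ → ℕ) : Finset ℕ :=
  {i ∈ Finset.Icc 1 n | ∀ j ≤ n, f j ≠ i ∧ ¬ (f j ≠ 0 ∧ f j < i ∧ i + 3 ≤ j)}

theorem mem_available {n : ℕ} {f : ℕ → ℕ} {i : ℕ} : i ∈ available n f ↔
    (1 ≤ i ∧ i ≤ n) ∧ ∀ j ≤ n, f j ≠ i ∧ ¬ (f j ≠ 0 ∧ f j < i ∧ i + 3 ≤ j) := by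
  simp [available]

theorem IsNoncrossingPred.update {n : ℕ} {f : ℕ → ℕ} (hf : IsNoncrossingPred n f) {c : ℕ}
    (hc : c ∈ insert 0 (available n f)) :
    IsNoncrossingPred (n + 1) (Function.update f (n + 1) c) := by
  rw [Finset.mem_insert, mem_available] at hc
  have hle := hf.le
  constructor
  · intro j; have := hf.lt j; grind
  · intro j; have := hf.le j; grind
  · intro j k; have := hf.inj j k; grind
  · intro j k; have := hf.noncrossing j k; grind

theorem IsNoncrossingPred.restrict {n : ℕ} {f : ℕ → ℕ} (hf : IsNoncrossingPred (n + 1) f) :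
    IsNoncrossingPred n (Function.update f (n + 1) 0) := by
  have hle := hf.le
  constructor
  · intro j; have := hf.lt j; grind
  · intro j; have := hf.le j; grind
  · intro j k; have := hf.inj j k; grind
  · intro j k; have := hf.noncrossing j k; grind

theorem IsNoncrossingPred.apply_mem_available {n : ℕ} {f : ℕ → ℕ}
    (hf : IsNoncrossingPred (n + 1) f) :
    f (n + 1) ∈ insert 0 (available n (Function.update f (n + 1) 0)) := by
  rw [Finset.mem_insert, mem_available]
  by_cases h : f (n + 1) = 0
  · exact Or.inl h
  have hlt := hf.lt (n + 1) h
  refine Or.inr ⟨by lia, fun j hj => ?_⟩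
  rw [Function.update_of_ne (by lia)]
  have := hf.inj (n + 1) j h
  have := hf.noncrossing j (n + 1)
  grind

open Classical in
/-- The predecessor functions of `3`-distant noncrossing partitions of `[n]`, built by choosing the
predecessors of `1, …, n` in turn; see `mem_noncrossingPreds`. -/
noncomputable def noncrossingPreds : ℕ → Finset (ℕ → ℕ)
  | 0 => {0}
  | n + 1 => ((noncrossingPreds n).sigma fun f => insert 0 (available n f)).image
      fun x => Function.update x.1 (n + 1) x.2

theorem mem_noncrossingPreds {n : ℕ} {f : ℕ → ℕ} :
    f ∈ noncrossingPreds n ↔ IsNoncrossingPred n f := by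
  induction n generalizing f with
  | zero =>
    rw [noncrossingPreds, Finset.mem_singleton]
    constructor
    · rintro rfl
      constructor <;> simp
    · intro hf
      ext j
      by_contra h
      have := hf.lt j h
      have := hf.le j h
      lia
  | succ n ih =>
    simp only [noncrossingPreds, Finset.mem_image, Finset.mem_sigma, ih]
    constructor
    · rintro ⟨⟨f, c⟩, ⟨hf, hc⟩, rfl⟩
      exact hf.update hc
    · intro hf
      exact ⟨⟨Function.update f (n + 1) 0, f (n + 1)⟩, ⟨hf.restrict, hf.apply_mem_available⟩,
        by rw [Function.update_idem, Function.update_eq_self]⟩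

open Classical in
theorem sum_noncrossingPreds_succ (n : ℕ) (φ : (ℕ → ℕ) → ℕ) :
    ∑ f ∈ noncrossingPreds (n + 1), φ f = ∑ f ∈ noncrossingPreds n,
      ∑ c ∈ insert 0 (available n f), φ (Function.update f (n + 1) c) := by
  rw [noncrossingPreds, Finset.sum_image, Finset.sum_sigma]
  rintro ⟨f, c⟩ hf ⟨g, d⟩ hg h
  simp only [Finset.coe_sigma, Set.mem_sigma_iff, Finset.mem_coe, mem_noncrossingPreds] at hf hg h
  have hf0 : f (n + 1) = 0 := by_contra fun h0 => by have := hf.1.le _ h0; lia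
  have hg0 : g (n + 1) = 0 := by_contra fun h0 => by have := hg.1.le _ h0; lia
  have hcd : c = d := by simpa using congrFun h (n + 1)
  have hfg : f = g := by
    ext j
    have := congrFun h j
    by_cases hj : j = n + 1
    · rw [hj, hf0, hg0]
    · simpa [hj] using this
  rw [hcd, hfg]

/-! ### Adding a vertex -/

/-- The available vertices after `n + 1` has received the predecessor `c` (`c = 0` for none), if `A`
are those of `[n]`. -/
def nextAvailable (n : ℕ) (A : Finset ℕ) (c : ℕ) : Finset ℕ :=
  {i ∈ insert (n + 1) A | i ≠ c ∧ ¬ (c ≠ 0 ∧ c < i ∧ i + 2 ≤ n)}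

theorem available_update {n : ℕ} {f : ℕ → ℕ} {c : ℕ} (hf : IsNoncrossingPred n f)
    (hc : c ∈ insert 0 (available n f)) :
    available (n + 1) (Function.update f (n + 1) c) = nextAvailable n (available n f) c := by
  have hlt := hf.lt
  have hc' : c ≤ n := by
    rw [Finset.mem_insert, mem_available] at hc
    lia
  ext i
  simp only [nextAvailable, Finset.mem_filter, Finset.mem_insert, mem_available]
  constructor
  · rintro ⟨hi, h⟩
    have h1 := h (n + 1) le_rfl
    rw [Function.update_self] at h1
    refine ⟨?_, by lia⟩
    by_cases hin : i = n + 1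
    · exact Or.inl hin
    · refine Or.inr ⟨by lia, fun j hj => ?_⟩
      have := h j (by lia)
      rwa [Function.update_of_ne (by lia)] at this
  · rintro ⟨hi, h⟩
    refine ⟨by lia, fun j hj => ?_⟩
    by_cases hjn : j = n + 1
    · subst hjn
      rw [Function.update_self]
      lia
    · rw [Function.update_of_ne hjn]
      rcases hi with rfl | hi
      · have := hlt j
        lia
      · exact hi.2 j (by lia)

/-- The number of ways to add `m` vertices after `n + 1`, if `A` is the set of available vertices of
`[n + 1]`. -/
def completionCount (m n : ℕ) (A : Finset ℕ) : ℕ :=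
  extensionCount m {i ∈ A | i < n}.card (decide (n ∈ A))

/-- The elements of `S` are enumerated by their ranks. -/
theorem sum_card_filter_lt (S : Finset ℕ) (φ : ℕ → ℕ) :
    ∑ c ∈ S, φ {i ∈ S | i < c}.card = ∑ k ∈ Finset.range S.card, φ k := by
  induction S using Finset.induction_on_max with
  | empty => simp
  | insert a S ha ih =>
    have haS : a ∉ S := fun h => lt_irrefl _ (ha a h)
    rw [Finset.sum_insert haS, Finset.card_insert_of_notMem haS, Finset.sum_range_succ, ← ih,
      add_comm]
    congr 1
    · refine Finset.sum_congr rfl fun c hc => ?_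
      have := ha c hc
      rw [Finset.filter_insert, if_neg (by lia)]
    · rw [Finset.filter_insert, if_neg (lt_irrefl a), Finset.filter_true_of_mem ha]

/-- The recursion of `extensionCount` is a case distinction on the predecessor `c` of the new
vertex `n + 2`. -/
theorem completionCount_succ {m n : ℕ} {A : Finset ℕ} (hA : A ⊆ Finset.Icc 1 (n + 1))
    (hn : n + 1 ∈ A) :
    completionCount (m + 1) n A =
      ∑ c ∈ insert 0 A, completionCount m (n + 1) (nextAvailable (n + 1) A c) := by
  have hA' : ∀ i ∈ A, 1 ≤ i ∧ i ≤ n + 1 := fun i hi => Finset.mem_Icc.1 (hA hi)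
  have h0 : 0 ∉ A := fun h => by have := hA' 0 h; lia
  have hlt : {i ∈ A | i < n + 1} =
      if n ∈ A then insert n {i ∈ A | i < n} else {i ∈ A | i < n} := by
    ext i
    split_ifs <;> grind
  have hfull : {i ∈ A | i < n + 1}.card = {i ∈ A | i < n}.card + if n ∈ A then 1 else 0 := by
    rw [hlt]
    split_ifs
    · rw [Finset.card_insert_of_notMem (by simp)]
    · rfl
  have hsum : ∀ φ : ℕ → ℕ, ∑ c ∈ A, φ c =
      ∑ c ∈ A with c < n, φ c + (if n ∈ A then φ n else 0) + φ (n + 1) := by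
    intro φ
    have hA1 : A = insert (n + 1) {i ∈ A | i < n + 1} := by
      ext i
      have := hA' i
      grind
    conv_lhs => rw [hA1]
    rw [Finset.sum_insert (by simp), hlt, add_comm (φ (n + 1))]
    split_ifs
    · rw [Finset.sum_insert (by simp), add_comm (φ n)]
    · rfl
  have hcount : ∀ c (S : Finset ℕ), {i ∈ nextAvailable (n + 1) A c | i < n + 1} = S →
      completionCount m (n + 1) (nextAvailable (n + 1) A c) =
        extensionCount m S.card (decide (n + 1 ≠ c)) := by
    rintro c S rfl
    have : n + 1 ∈ nextAvailable (n + 1) A c ↔ n + 1 ≠ c := by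
      simp [nextAvailable, hn]
    simp only [completionCount, this]
  have hzero : completionCount m (n + 1) (nextAvailable (n + 1) A 0) =
      extensionCount m {i ∈ A | i < n + 1}.card true := by
    rw [hcount 0 {i ∈ A | i < n + 1}]
    · simp
    · ext i
      simp only [nextAvailable]
      grind
  have hlast : completionCount m (n + 1) (nextAvailable (n + 1) A (n + 1)) =
      extensionCount m {i ∈ A | i < n + 1}.card false := by
    rw [hcount (n + 1) {i ∈ A | i < n + 1}]
    · simp
    · ext i
      simp only [nextAvailable]
      grind
  have hpenult : n ∈ A → completionCount m (n + 1) (nextAvailable (n + 1) A n) =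
      extensionCount m {i ∈ A | i < n}.card true := by
    intro hnA
    rw [hcount n {i ∈ A | i < n}]
    · simp
    · ext i
      simp only [nextAvailable]
      grind
  have hold : ∑ c ∈ A with c < n, completionCount m (n + 1) (nextAvailable (n + 1) A c) =
      ∑ k ∈ Finset.range {i ∈ A | i < n}.card,
        extensionCount m (k + if n ∈ A then 1 else 0) true := by
    rw [← sum_card_filter_lt]
    refine Finset.sum_congr rfl fun c hc => ?_
    rw [Finset.mem_filter] at hc
    have hc0 : c ≠ 0 := fun h => h0 (h ▸ hc.1)
    rw [hcount c (if n ∈ A then insert n {i ∈ {i ∈ A | i < n} | i < c}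
      else {i ∈ {i ∈ A | i < n} | i < c})]
    · rw [decide_eq_true (by lia)]
      split_ifs
      · rw [Finset.card_insert_of_notMem (by simp)]
      · rfl
    · ext i
      simp only [nextAvailable]
      split_ifs <;> grind
  rw [Finset.sum_insert h0, hsum, hzero, hlast, hold, hfull]
  by_cases hnA : n ∈ A
  · rw [if_pos hnA, if_pos hnA, hpenult hnA, completionCount, decide_eq_true hnA, extensionCount]
    ring
  · rw [if_neg hnA, if_neg hnA, completionCount, decide_eq_false hnA, extensionCount]
    simp only [add_zero]
    ring

/-- Every partition of `[n + 1 + m]` arises in exactly one way from its restriction to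
`[n + 1]`. -/
theorem sum_completionCount (m n : ℕ) :
    ∑ f ∈ noncrossingPreds (n + 1), completionCount m n (available (n + 1) f) =
      (noncrossingPreds (n + 1 + m)).card := by
  induction m generalizing n with
  | zero => simp [completionCount, extensionCount]
  | succ m ih =>
    rw [show n + 1 + (m + 1) = n + 1 + 1 + m by ring, ← ih, sum_noncrossingPreds_succ (n + 1)]
    refine Finset.sum_congr rfl fun f hf => ?_
    rw [mem_noncrossingPreds] at hf
    rw [completionCount_succ (A := available (n + 1) f) (Finset.filter_subset _ _)]
    · exact Finset.sum_congr rfl fun c hc => by rw [available_update hf hc]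
    · refine mem_available.2 ⟨by lia, fun j hj => ?_⟩
      have := hf.lt j
      lia

theorem card_noncrossingPreds_succ (n : ℕ) :
    (noncrossingPreds (n + 1)).card = extensionCount n 0 false := by
  have h1 : available 1 0 = {1} := by
    ext i
    simp only [mem_available, Finset.mem_singleton, Pi.zero_apply]
    grind
  have h2 : noncrossingPreds 1 = {0} := by
    ext f
    simp [noncrossingPreds, available, eq_comm]
  rw [add_comm, ← zero_add 1, ← sum_completionCount n 0, zero_add, h2, Finset.sum_singleton, h1]
  simp [completionCount]

/-! ### The predecessor function of a partition -/

/-- The predecessor function of a partition: the largest smaller element of the block of `j`, and `0`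
(the supremum of the empty set) if `j` is minimal in its block or `j ∉ [n]`. -/
def Finpartition.pred {n : ℕ} (P : Finpartition (Finset.Icc 1 n)) (j : ℕ) : ℕ :=
  ({i ∈ P.part j | i < j} : Finset ℕ).sup id

theorem Finpartition.pred_eq_iff {n : ℕ} (P : Finpartition (Finset.Icc 1 n)) {i j : ℕ}
    (hi : i ≠ 0) : P.pred j = i ↔ IsStandardEdge P i j := by
  constructor
  · intro h
    have hne : ({i ∈ P.part j | i < j} : Finset ℕ).Nonempty := by
      by_contra hne
      rw [Finset.not_nonempty_iff_eq_empty] at hne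
      rw [Finpartition.pred, hne] at h
      exact hi h.symm
    obtain ⟨a, ha, hsup⟩ := Finset.exists_mem_eq_sup _ hne id
    have hai : a = i := by rw [← h, Finpartition.pred, hsup, id]
    subst hai
    rw [Finset.mem_filter] at ha
    have hj : j ∈ Finset.Icc 1 n := P.part_nonempty.1 ⟨a, ha.1⟩
    refine ⟨ha.2, P.part j, P.part_mem.2 hj, ha.1, P.mem_part hj, fun m hm hmm => ?_⟩
    have : m ≤ P.pred j :=
      Finset.le_sup (f := id) (Finset.mem_filter.2 ⟨hm, hmm.2⟩)
    lia
  · rintro ⟨hij, B, hB, hiB, hjB, hbetween⟩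
    rw [Finpartition.pred, P.part_eq_of_mem hB hjB]
    refine le_antisymm (Finset.sup_le fun m hm => ?_)
      (Finset.le_sup (f := id) (Finset.mem_filter.2 ⟨hiB, hij⟩))
    rw [Finset.mem_filter] at hm
    have := hbetween m hm.1
    simp only [id]
    lia

theorem IsStandardEdge.mem_Icc {n : ℕ} {P : Finpartition (Finset.Icc 1 n)} {i j : ℕ}
    (h : IsStandardEdge P i j) : i ∈ Finset.Icc 1 n ∧ j ∈ Finset.Icc 1 n := by
  obtain ⟨-, B, hB, hi, hj, -⟩ := h
  exact ⟨P.le hB hi, P.le hB hj⟩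

theorem IsStandardEdge.part_eq {n : ℕ} {P : Finpartition (Finset.Icc 1 n)} {i j : ℕ}
    (h : IsStandardEdge P i j) : P.part i = P.part j := by
  obtain ⟨-, B, hB, hi, hj, -⟩ := h
  rw [P.part_eq_of_mem hB hi, P.part_eq_of_mem hB hj]

theorem Finpartition.isStandardEdge_pred {n : ℕ} (P : Finpartition (Finset.Icc 1 n)) {j : ℕ}
    (hj : P.pred j ≠ 0) : IsStandardEdge P (P.pred j) j :=
  (P.pred_eq_iff hj).1 rfl

theorem isNoncrossingPred_pred_iff {n : ℕ} (P : Finpartition (Finset.Icc 1 n)) :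
    IsNoncrossingPred n P.pred ↔ IsDistantNoncrossing 3 P := by
  constructor
  · rintro hf i₁ j₁ i₂ j₂ ⟨h₁, h₂, hi, -, hj, h3⟩
    have hi₁ := (Finset.mem_Icc.1 h₁.mem_Icc.1).1
    have hi₂ := (Finset.mem_Icc.1 h₂.mem_Icc.1).1
    have e₁ := (P.pred_eq_iff (by lia)).2 h₁
    have e₂ := (P.pred_eq_iff (by lia)).2 h₂
    exact hf.noncrossing j₁ j₂ (by lia) ⟨by lia, by lia, hj⟩
  · intro hP
    refine ⟨fun j hj => (P.isStandardEdge_pred hj).1,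
      fun j hj => (Finset.mem_Icc.1 (P.isStandardEdge_pred hj).mem_Icc.2).2, ?_, ?_⟩
    · intro j k hj hjk
      obtain ⟨hlt, B, hB, hiB, hjB, hb⟩ := P.isStandardEdge_pred hj
      obtain ⟨hlt', C, hC, hiC, hkC, hc⟩ := P.isStandardEdge_pred (hjk ▸ hj)
      rw [← hjk] at hlt' hiC hc
      obtain rfl := P.eq_of_mem_parts hB hC hiB hiC
      have := hb k hkC
      have := hc j hjB
      lia
    · rintro j k hj ⟨h1, h2, h3⟩
      exact hP _ _ _ _ ⟨P.isStandardEdge_pred hj, P.isStandardEdge_pred (by lia), h1,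
        by lia, h3, h2⟩

/-- The end of the chain `j, f j, f (f j), …`, followed while its terms are nonzero and decrease. For
the predecessor function of a partition this is the minimum of the block of `j`. -/
def chainRoot (f : ℕ → ℕ) (j : ℕ) : ℕ :=
  if _h : f j ≠ 0 ∧ f j < j then chainRoot f (f j) else j
termination_by j
decreasing_by exact _h.2

theorem chainRoot_of_eq_zero {f : ℕ → ℕ} {j : ℕ} (h : f j = 0) : chainRoot f j = j := by
  rw [chainRoot, dif_neg (by simp [h])]

theorem chainRoot_of_lt {f : ℕ → ℕ} {j : ℕ} (h : f j ≠ 0) (hlt : f j < j) :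
    chainRoot f j = chainRoot f (f j) := by
  rw [chainRoot, dif_pos ⟨h, hlt⟩]

theorem chainRoot_le (f : ℕ → ℕ) (j : ℕ) : chainRoot f j ≤ j := by
  induction j using Nat.strong_induction_on with
  | _ j ih =>
    rw [chainRoot]
    split_ifs with h
    · exact (ih _ h.2).trans h.2.le
    · exact le_rfl

theorem ne_zero_of_chainRoot_eq {f : ℕ → ℕ} {i j : ℕ}
    (hij : i < j) (h : chainRoot f i = chainRoot f j) : f j ≠ 0 := by
  intro h0
  rw [chainRoot_of_eq_zero h0] at h
  have := chainRoot_le f i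
  lia

/-- Vertices with the same root lie on a single chain. Were `f j < i < j` with equal roots, then
`i` and `f j` would again have equal roots, and so would `f i` and `j`; the two smaller instances give
`f i = f j`, against injectivity. -/
theorem IsNoncrossingPred.le_of_chainRoot_eq {n : ℕ} {f : ℕ → ℕ} (hf : IsNoncrossingPred n f)
    {i j : ℕ} (hij : i < j) (h : chainRoot f i = chainRoot f j) : i ≤ f j := by
  induction hN : i + j using Nat.strong_induction_on generalizing i j with
  | _ N ih =>
    by_contra! hlt
    have hj0 := ne_zero_of_chainRoot_eq hij h
    have hrj := chainRoot_of_lt hj0 (hf.lt j hj0)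
    have hi0 := ne_zero_of_chainRoot_eq hlt (hrj.symm.trans h.symm)
    have hri := chainRoot_of_lt hi0 (hf.lt i hi0)
    have hne : f i ≠ f j := fun e => hij.ne (hf.inj i j hi0 e)
    have hil := hf.lt i hi0
    have h1 : f j ≤ f i := ih (f j + i) (by lia) hlt (hrj.symm.trans h.symm) rfl
    have h2 : f i ≤ f j := ih (f i + j) (by lia) (by lia) (hri.symm.trans h) rfl
    lia

theorem Finpartition.part_chainRoot_pred {n : ℕ} (P : Finpartition (Finset.Icc 1 n)) (j : ℕ) :
    P.part (chainRoot P.pred j) = P.part j := by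
  induction j using Nat.strong_induction_on with
  | _ j ih =>
    rw [chainRoot]
    split_ifs with h
    · rw [ih _ h.2, (P.isStandardEdge_pred h.1).part_eq]
    · rfl

theorem Finpartition.pred_chainRoot_pred {n : ℕ} (P : Finpartition (Finset.Icc 1 n)) (j : ℕ) :
    P.pred (chainRoot P.pred j) = 0 := by
  induction j using Nat.strong_induction_on with
  | _ j ih =>
    rw [chainRoot]
    split_ifs with h
    · exact ih _ h.2
    · by_contra h0
      exact h ⟨h0, (P.isStandardEdge_pred h0).1⟩

theorem Finpartition.chainRoot_pred_le {n : ℕ} (P : Finpartition (Finset.Icc 1 n)) {i j : ℕ}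
    (h : i ∈ P.part j) : chainRoot P.pred j ≤ i := by
  by_contra! hlt
  have hle : i ≤ P.pred (chainRoot P.pred j) :=
    Finset.le_sup (f := id) (Finset.mem_filter.2 ⟨by rwa [P.part_chainRoot_pred], hlt⟩)
  rw [P.pred_chainRoot_pred] at hle
  have := (Finset.mem_Icc.1 (P.part_subset j h)).1
  lia

theorem Finpartition.part_eq_part_iff_chainRoot_pred {n : ℕ} (P : Finpartition (Finset.Icc 1 n))
    {i j : ℕ} (hi : i ∈ Finset.Icc 1 n) (hj : j ∈ Finset.Icc 1 n) :
    P.part i = P.part j ↔ chainRoot P.pred i = chainRoot P.pred j := by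
  have hroot : ∀ k ∈ Finset.Icc 1 n, chainRoot P.pred k ∈ P.part k := fun k hk => by
    have hk' : chainRoot P.pred k ∈ Finset.Icc 1 n := by
      rwa [← P.part_nonempty, P.part_chainRoot_pred, P.part_nonempty]
    rw [← P.part_chainRoot_pred]
    exact P.mem_part hk'
  constructor
  · intro h
    exact le_antisymm (P.chainRoot_pred_le (h ▸ hroot j hj)) (P.chainRoot_pred_le (h ▸ hroot i hi))
  · intro h
    rw [← P.part_chainRoot_pred i, h, P.part_chainRoot_pred]

/-- Two elements are in the same block iff their chains of predecessors end at the same vertex, so the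
predecessor function determines the partition. -/
theorem Finpartition.pred_injective (n : ℕ) :
    Function.Injective (Finpartition.pred : Finpartition (Finset.Icc 1 n) → ℕ → ℕ) := by
  intro P Q hPQ
  have hpart : ∀ i ∈ Finset.Icc 1 n, P.part i = Q.part i := by
    intro i hi
    ext j
    by_cases hj : j ∈ Finset.Icc 1 n
    · rw [P.mem_part_iff_part_eq_part hj hi, Q.mem_part_iff_part_eq_part hj hi,
        P.part_eq_part_iff_chainRoot_pred hj hi, Q.part_eq_part_iff_chainRoot_pred hj hi, hPQ]
    · exact ⟨fun h => absurd (P.part_subset i h) hj, fun h => absurd (Q.part_subset i h) hj⟩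
  ext B
  constructor
  · intro hB
    obtain ⟨i, hi⟩ := P.nonempty_of_mem_parts hB
    have hi' := P.le hB hi
    rw [← P.part_eq_of_mem hB hi, hpart i hi']
    exact Q.part_mem.2 hi'
  · intro hB
    obtain ⟨i, hi⟩ := Q.nonempty_of_mem_parts hB
    have hi' := Q.le hB hi
    rw [← Q.part_eq_of_mem hB hi, ← hpart i hi']
    exact P.part_mem.2 hi'

open Classical in
/-- The blocks are the fibres of `chainRoot f`. -/
theorem IsNoncrossingPred.exists_pred_eq {n : ℕ} {f : ℕ → ℕ} (hf : IsNoncrossingPred n f) :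
    ∃ P : Finpartition (Finset.Icc 1 n), P.pred = f := by
  let P := Finpartition.ofSetSetoid (Setoid.ker (chainRoot f)) (Finset.Icc 1 n)
  have hP : ∀ i j, i ∈ P.part j ↔
      j ∈ Finset.Icc 1 n ∧ i ∈ Finset.Icc 1 n ∧ chainRoot f j = chainRoot f i :=
    fun i j => Finpartition.mem_part_ofSetSetoid_iff_rel _
  refine ⟨P, funext fun j => ?_⟩
  by_cases hj0 : f j = 0
  · rw [hj0]
    by_contra hne
    have hedge := P.isStandardEdge_pred hne
    have hmem : P.pred j ∈ P.part j := hedge.part_eq ▸ P.mem_part hedge.mem_Icc.1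
    exact ne_zero_of_chainRoot_eq hedge.1 ((hP _ _).1 hmem).2.2.symm hj0
  · have hlt := hf.lt j hj0
    have hle := hf.le j hj0
    have hj : j ∈ Finset.Icc 1 n := Finset.mem_Icc.2 ⟨by lia, hle⟩
    refine (P.pred_eq_iff hj0).2 ⟨hlt, P.part j, P.part_mem.2 hj, (hP _ _).2 ⟨hj,
      Finset.mem_Icc.2 ⟨by lia, by lia⟩, chainRoot_of_lt hj0 hlt⟩, P.mem_part hj, ?_⟩
    rintro m hm ⟨h1, h2⟩
    have := hf.le_of_chainRoot_eq h2 ((hP _ _).1 hm).2.2.symm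
    lia

theorem distantNoncrossingCount_three (n : ℕ) :
    distantNoncrossingCount 3 n = (noncrossingPreds n).card := by
  rw [distantNoncrossingCount, ← Fintype.card_coe, ← Nat.card_eq_fintype_card]
  refine Nat.card_eq_of_bijective
    (fun P => ⟨P.1.pred, mem_noncrossingPreds.2 ((isNoncrossingPred_pred_iff P.1).2 P.2)⟩)
    ⟨fun P Q h => Subtype.ext (Finpartition.pred_injective n (congrArg Subtype.val h)), ?_⟩
  rintro ⟨f, hf⟩
  rw [mem_noncrossingPreds] at hf
  obtain ⟨P, rfl⟩ := hf.exists_pred_eq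
  exact ⟨⟨P, (isNoncrossingPred_pred_iff P).1 hf⟩, rfl⟩

theorem corollary3p5 (b lam : ℕ → ℝ)
    (hb₀ : b 0 = 1) (hb₁ : b 1 = 2) (hb : ∀ i : ℕ, 2 ≤ i → b i = 3)
    (hlam₁ : lam 1 = 1) (hlam : ∀ i : ℕ, 2 ≤ i → lam i = 2) (n : ℕ) :
    (distantNoncrossingCount 3 n : ℝ) = motzkinWeightSum b lam n := by
  rw [distantNoncrossingCount_three, motzkinWeightSum_eq_from, ← Nat.cast_zero,
    ← coeff_motzkinSeries hb₀ hb₁ hb hlam₁ hlam n 0, motzkinSeries_zero_eq_extensionSeries]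
  cases n with
  | zero => simp [noncrossingPreds]
  | succ n =>
    rw [map_add, PowerSeries.coeff_succ_X_mul, coeff_extensionSeries, card_noncrossingPreds_succ]
    simp [PowerSeries.coeff_one]
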